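/- Let $n \ge 1$ be an integer, let $I^n = [0,1]^n \subset \mathbb{R}^n$, and let $f \colon I^n \to \mathbb{R}^{n-1}$ be a continuous function (where $\mathbb{R}^0 = \{0\}$). Then there exist a point $p \in \mathbb{R}^{n-1}$ and a compact connected set $S \subset f^{-1}[\{p\}]$ such that, for some $i \in \{1, \dots, n\}$, the set $S$ meets both opposite faces $\{z \in I^n : z_i = 0\}$ and $\{z \in I^n : z_i = 1\}$ of the cube. -/

import Mathlib

/-- The `n`-dimensional unit cube `[0, 1]^n` in `ℝ^n`. -/
def unitCube (n : ℕ) : Set (Fin n → ℝ) :=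
  {z | ∀ i, z i ∈ Set.Icc (0 : ℝ) 1}

/-- The face of the unit cube on which the `i`-th coordinate is `0`. -/
def lowerFace (n : ℕ) (i : Fin n) : Set (Fin n → ℝ) :=
  {z | z ∈ unitCube n ∧ z i = 0}

/-- The face of the unit cube on which the `i`-th coordinate is `1`. -/
def upperFace (n : ℕ) (i : Fin n) : Set (Fin n → ℝ) :=
  {z | z ∈ unitCube n ∧ z i = 1}

/-- `S` is a connected subset of the unit cube that meets both `i`-th opposite faces. -/
def ConnectsFaces (n : ℕ) (i : Fin n) (S : Set (Fin n → ℝ)) : Prop :=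
  S ⊆ unitCube n ∧ IsConnected S ∧
    (S ∩ lowerFace n i).Nonempty ∧ (S ∩ upperFace n i).Nonempty

/-- `S` connects the `i`-th opposite faces of the unit cube for some `i`. -/
def ConnectsSomeFaces (n : ℕ) (S : Set (Fin n → ℝ)) : Prop :=
  ∃ i : Fin n, ConnectsFaces n i S

/-!
Suppose no fiber contains a continuum joining opposite faces. Then, for every `i`, each fiber splits
into two closed pieces, each missing one of the two `i`-th faces, and these pieces spread to
disjoint open sets covering the preimage of a neighborhood of the value. Cover `ℝ ^ (n - 1)` by `n`
families of small disjoint open boxes: `n` translates of a cubical grid, chosen such that every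
point lies off the walls of at least one. Using the `i`-th family to glue the pieces for the `i`-th
pair of faces, one covers the cube by open sets `L i ∪ R i`, where `L i` and `R i` are disjoint and
miss the upper and the lower `i`-th face. This contradicts a covering form of the Poincaré–Miranda
theorem, which follows from a discrete one: the coboundaries of `n` labelings `g i` of a lattice
cube with `g i = 0` and `g i = 1` on the two `i`-th faces have a cup product of total mass `1`
modulo `2`, so on some unit cube no `g i` is constant.
-/

/-! ### Cubical cochains modulo two -/

theorem sum_sum_erase_eq_zero {ι M : Type*} [DecidableEq ι] [AddCommMonoid M] (J : Finset ι)
    {a : ι → ι → M} (ha : ∀ i j, a i j + a j i = 0) :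
    ∑ i ∈ J, ∑ j ∈ J.erase i, a i j = 0 := by
  rw [Finset.sum_sigma']
  refine Finset.sum_involution (fun p _ => ⟨p.2, p.1⟩) (fun p _ => ha p.1 p.2) ?_ ?_
    fun _ _ => rfl
  · rintro ⟨i, j⟩ hij - hfix
    simp only [Finset.mem_sigma, Finset.mem_erase, Sigma.mk.injEq] at hij hfix
    exact hij.2.1 hfix.1
  · rintro ⟨i, j⟩ hij
    simp only [Finset.mem_sigma, Finset.mem_erase] at hij ⊢
    exact ⟨hij.2.2, hij.2.1.symm, hij.1⟩

/-- Cubical cochains modulo `2` on the lattice `ι → ℕ`: `ω J x` is the value of `ω` on the unit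
cube with lowest vertex `x` and edge directions `J`. Cochains of all degrees are combined, the
degree of the cube being `J.card`. -/
abbrev CubicalCochain (ι : Type*) : Type _ := Finset ι → (ι → ℕ) → ZMod 2

namespace CubicalCochain

variable {ι : Type*} [DecidableEq ι]

/-- The coboundary of a cochain: its value on a cube is the sum over the facets of the cube. -/
def coboundary (ω : CubicalCochain ι) : CubicalCochain ι := fun J x =>
  ∑ j ∈ J, (ω (J.erase j) (x + Pi.single j 1) + ω (J.erase j) x)

theorem coboundary_coboundary (ω : CubicalCochain ι) : coboundary (coboundary ω) = 0 := by
  funext J x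
  simp only [coboundary, ← Finset.sum_add_distrib]
  refine sum_sum_erase_eq_zero J fun i j => ?_
  rw [Finset.erase_right_comm, add_right_comm x (Pi.single j 1)]
  linear_combination CharTwo.two_eq_zero (R := ZMod 2) *
    (ω ((J.erase j).erase i) (x + Pi.single i 1 + Pi.single j 1) +
      ω ((J.erase j).erase i) (x + Pi.single i 1) +
      ω ((J.erase j).erase i) (x + Pi.single j 1) + ω ((J.erase j).erase i) x)

/-- The cup product `δg₁ ∪ ⋯ ∪ δgₖ` of the coboundaries of a list of `0`-cochains, built up
through `δg ∪ ω = δ(g ∪ ω)`, which holds because `ω` is closed. It is meaningful on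
`k`-dimensional cubes only. -/
def cupCoboundaries : List ((ι → ℕ) → ZMod 2) → CubicalCochain ι
  | [] => 1
  | g :: gs => coboundary fun J x => g x * cupCoboundaries gs J x

theorem coboundary_cupCoboundaries (gs : List ((ι → ℕ) → ZMod 2)) :
    coboundary (cupCoboundaries gs) = 0 := by
  cases gs with
  | nil =>
    funext J x
    exact Finset.sum_eq_zero fun _ _ => CharTwo.add_self_eq_zero _
  | cons g gs => exact coboundary_coboundary _

theorem Icc_facet_lower_subset (J : Finset ι) (j : ι) (x : ι → ℕ) :
    Set.Icc x (x + Set.indicator (J.erase j) 1) ⊆ Set.Icc x (x + Set.indicator J 1) :=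
  Set.Icc_subset_Icc_right <| by
    gcongr
    exact Finset.erase_subset j J

theorem Icc_facet_upper_subset {J : Finset ι} {j : ι} (hj : j ∈ J) (x : ι → ℕ) :
    Set.Icc (x + Pi.single j 1) (x + Pi.single j 1 + Set.indicator (J.erase j) 1) ⊆
      Set.Icc x (x + Set.indicator J 1) := by
  refine Set.Icc_subset_Icc le_self_add (le_of_eq ?_)
  funext k
  rcases eq_or_ne k j with rfl | hk
  · simp [hj]
  · simp [Set.indicator, hk]

theorem cupCoboundaries_eq_zero_of_const {gs : List ((ι → ℕ) → ZMod 2)} {g : (ι → ℕ) → ZMod 2}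
    (hg : g ∈ gs) {J : Finset ι} {x : ι → ℕ} {a : ZMod 2}
    (ha : ∀ y ∈ Set.Icc x (x + Set.indicator J 1), g y = a) : cupCoboundaries gs J x = 0 := by
  induction gs generalizing J x with
  | nil => simp at hg
  | cons g' gs ih =>
    have ha_lower (j : ι) (y) (hy : y ∈ Set.Icc x (x + Set.indicator (J.erase j) 1)) :=
      ha y (Icc_facet_lower_subset J j x hy)
    have ha_upper (j : ι) (hj : j ∈ J) (y) (hy : y ∈ Set.Icc (x + Pi.single j 1) _) :=
      ha y (Icc_facet_upper_subset hj x hy)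
    rw [cupCoboundaries, coboundary]
    rcases List.mem_cons.1 hg with rfl | hg
    · calc
        _ = ∑ j ∈ J, a * (cupCoboundaries gs (J.erase j) (x + Pi.single j 1) +
              cupCoboundaries gs (J.erase j) x) := by
          refine Finset.sum_congr rfl fun j hj => ?_
          rw [ha_upper j hj _ (Set.left_mem_Icc.2 le_self_add),
            ha_lower j _ (Set.left_mem_Icc.2 le_self_add), mul_add]
        _ = a * coboundary (cupCoboundaries gs) J x := by rw [← Finset.mul_sum, coboundary]
        _ = 0 := by rw [coboundary_cupCoboundaries, Pi.zero_apply, Pi.zero_apply, mul_zero]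
    · refine Finset.sum_eq_zero fun j hj => ?_
      rw [ih hg (ha_upper j hj), ih hg (ha_lower j), mul_zero, mul_zero, add_zero]

theorem cupCoboundaries_eq_zero_of_notMem {gs : List ((ι → ℕ) → ZMod 2)} {g : (ι → ℕ) → ZMod 2}
    (hg : g ∈ gs) {J : Finset ι} {j : ι} (hj : j ∉ J) {x : ι → ℕ} {a : ZMod 2}
    (ha : ∀ y, y j = x j → g y = a) : cupCoboundaries gs J x = 0 :=
  cupCoboundaries_eq_zero_of_const hg fun y hy =>
    ha y (le_antisymm (by simpa [hj] using hy.2 j) (hy.1 j))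

end CubicalCochain

/-! ### The discrete Poincaré–Miranda theorem -/

/-- The lattice points whose coordinates in `J` are less than `M` and whose other coordinates
are those of `c`: the lowest vertices of the unit `J`-cubes that tile the `J`-face through `c` of
a lattice cube of side `M`. -/
def latticeBox {ι : Type*} [DecidableEq ι] [Fintype ι] (M : ℕ) (J : Finset ι) (c : ι → ℕ) :
    Finset (ι → ℕ) :=
  Fintype.piFinset fun i => if i ∈ J then Finset.range M else {c i}

section LatticeBox

open CubicalCochain

variable {ι : Type*} [DecidableEq ι] [Fintype ι] {M : ℕ} {J : Finset ι} {j : ι}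

theorem mem_latticeBox {c x : ι → ℕ} :
    x ∈ latticeBox M J c ↔ ∀ i, if i ∈ J then x i < M else x i = c i := by
  simp only [latticeBox, Fintype.mem_piFinset]
  refine forall_congr' fun i => ?_
  split_ifs <;> simp

theorem latticeBox_empty (c : ι → ℕ) : latticeBox M ∅ c = {c} := by
  ext x
  simp [mem_latticeBox, funext_iff]

theorem apply_eq_of_mem_latticeBox_update (hj : j ∉ J) {c x : ι → ℕ} {t : ℕ}
    (hx : x ∈ latticeBox M J (Function.update c j t)) : x j = t := by
  simpa [hj] using mem_latticeBox.1 hx j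

theorem sum_latticeBox_update {A : Type*} [AddCommMonoid A] (hj : j ∉ J) (c : ι → ℕ) (t : ℕ)
    (F : (ι → ℕ) → A) :
    ∑ x ∈ latticeBox M J (Function.update c j t), F x =
      ∑ x ∈ latticeBox M J c, F (Function.update x j t) := by
  have hfix {y : ι → ℕ} {s : ℕ} (hy : y j = s) : Function.update y j s = y :=
    hy ▸ Function.update_eq_self j y
  refine Finset.sum_nbij' (Function.update · j (c j)) (Function.update · j t) ?_ ?_ ?_ ?_ ?_
  · intro x hx
    rw [mem_latticeBox] at hx ⊢
    grind
  · intro x hx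
    rw [mem_latticeBox] at hx ⊢
    grind
  · intro x hx
    simpa using hfix (apply_eq_of_mem_latticeBox_update hj hx)
  · intro x hx
    simpa using hfix (by simpa [hj] using mem_latticeBox.1 hx j)
  · intro x hx
    simp [hfix (apply_eq_of_mem_latticeBox_update hj hx)]

theorem sum_latticeBox_eq_sum_range {A : Type*} [AddCommMonoid A] (hj : j ∈ J) (c : ι → ℕ)
    (F : (ι → ℕ) → A) :
    ∑ x ∈ latticeBox M J c, F x =
      ∑ t ∈ Finset.range M, ∑ x ∈ latticeBox M (J.erase j) (Function.update c j t), F x := by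
  have hmaps (x) (hx : x ∈ latticeBox M J c) : x j ∈ Finset.range M := by
    simpa [hj] using mem_latticeBox.1 hx j
  rw [← Finset.sum_fiberwise_of_maps_to hmaps]
  refine Finset.sum_congr rfl fun t ht => Finset.sum_congr ?_ fun _ _ => rfl
  ext x
  rw [Finset.mem_filter, mem_latticeBox, mem_latticeBox]
  grind

theorem sum_latticeBox_sub {A : Type*} [AddCommGroup A] (hj : j ∈ J) (c : ι → ℕ)
    (F : (ι → ℕ) → A) :
    ∑ x ∈ latticeBox M J c, (F (x + Pi.single j 1) - F x) =
      ∑ x ∈ latticeBox M (J.erase j) (Function.update c j M), F x -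
        ∑ x ∈ latticeBox M (J.erase j) (Function.update c j 0), F x := by
  have hshift (x : ι → ℕ) (t : ℕ) :
      Function.update x j t + Pi.single j 1 = Function.update x j (t + 1) := by
    funext k
    rcases eq_or_ne k j with rfl | hk <;> simp [*]
  rw [sum_latticeBox_eq_sum_range hj]
  simp only [sum_latticeBox_update (Finset.notMem_erase j J), hshift, Finset.sum_sub_distrib]
  rw [← Finset.sum_sub_distrib]
  exact Finset.sum_range_sub
    (fun t => ∑ x ∈ latticeBox M (J.erase j) c, F (Function.update x j t)) M

theorem sum_coboundary_latticeBox (ω : CubicalCochain ι) (J : Finset ι) (c : ι → ℕ) :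
    ∑ x ∈ latticeBox M J c, coboundary ω J x =
      ∑ j ∈ J, (∑ x ∈ latticeBox M (J.erase j) (Function.update c j M), ω (J.erase j) x -
        ∑ x ∈ latticeBox M (J.erase j) (Function.update c j 0), ω (J.erase j) x) := by
  simp only [coboundary, ← CharTwo.sub_eq_add]
  rw [Finset.sum_comm]
  exact Finset.sum_congr rfl fun j hj => sum_latticeBox_sub hj c (ω (J.erase j))

theorem sum_cupCoboundaries_latticeBox {g : ι → (ι → ℕ) → ZMod 2}
    (h0 : ∀ i x, x i = 0 → g i x = 0) (h1 : ∀ i x, x i = M → g i x = 1) {l : List ι}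
    (hl : l.Nodup) (c : ι → ℕ) :
    ∑ x ∈ latticeBox M l.toFinset c, cupCoboundaries (l.map g) l.toFinset x = 1 := by
  induction l generalizing c with
  | nil => simp [latticeBox_empty, cupCoboundaries]
  | cons i l ih =>
    obtain ⟨hil, hl⟩ := List.nodup_cons.1 hl
    have herase : (i :: l).toFinset.erase i = l.toFinset := by
      rw [List.toFinset_cons, Finset.erase_insert (by simpa using hil)]
    have happly {k : ι} {t : ℕ} {x : ι → ℕ}
        (hx : x ∈ latticeBox M ((i :: l).toFinset.erase k) (Function.update c k t)) : x k = t :=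
      apply_eq_of_mem_latticeBox_update (Finset.notMem_erase k _) hx
    rw [List.map_cons, cupCoboundaries, sum_coboundary_latticeBox,
      Finset.sum_eq_single_of_mem i (by simp)]
    · have hlower : ∑ x ∈ latticeBox M ((i :: l).toFinset.erase i) (Function.update c i 0),
          g i x * cupCoboundaries (l.map g) ((i :: l).toFinset.erase i) x = 0 :=
        Finset.sum_eq_zero fun x hx => by rw [h0 i x (happly hx), zero_mul]
      rw [hlower, sub_zero, ← ih hl (Function.update c i M), ← herase]
      exact Finset.sum_congr rfl fun x hx => by rw [h1 i x (happly hx), one_mul]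
    · intro k hk hki
      have hkl : k ∈ l := by simpa [hki] using hk
      have hzero {t : ℕ} {a : ZMod 2} (hconst : ∀ x, x k = t → g k x = a) :
          ∑ x ∈ latticeBox M ((i :: l).toFinset.erase k) (Function.update c k t),
            g i x * cupCoboundaries (l.map g) ((i :: l).toFinset.erase k) x = 0 :=
        Finset.sum_eq_zero fun x hx => by
          rw [cupCoboundaries_eq_zero_of_notMem (List.mem_map_of_mem hkl)
            (Finset.notMem_erase k _) fun y hy => hconst y (hy.trans (happly hx)), mul_zero]
      rw [hzero (h1 k), hzero (h0 k), sub_zero]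

end LatticeBox

theorem exists_lattice_cube_forall_exists_ne {ι : Type*} [Finite ι] {M : ℕ}
    {g : ι → (ι → ℕ) → ZMod 2} (h0 : ∀ i x, x i = 0 → g i x = 0)
    (h1 : ∀ i x, x i = M → g i x = 1) :
    ∃ x : ι → ℕ, ∀ i, ∃ y ∈ Set.Icc x (x + 1), g i y ≠ g i x := by
  classical
  cases nonempty_fintype ι
  have hsum := sum_cupCoboundaries_latticeBox h0 h1 Finset.univ.nodup_toList 0
  obtain ⟨x, -, hx⟩ := Finset.exists_ne_zero_of_sum_ne_zero (hsum.trans_ne one_ne_zero)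
  refine ⟨x, fun i => ?_⟩
  by_contra! hconst
  refine hx (CubicalCochain.cupCoboundaries_eq_zero_of_const (g := g i) (a := g i x) (by simp) ?_)
  simpa using hconst

/-! ### Separation between two sets -/

/-- `K` is separated between `A` and `B`: it splits into two relatively open pieces, one missing
`B` and the other missing `A`. The pieces are given by disjoint open subsets of the whole space,
themselves required to miss `B` and `A`. -/
def SeparatedBetween {X : Type*} [TopologicalSpace X] (K A B : Set X) : Prop :=
  ∃ U V, IsOpen U ∧ IsOpen V ∧ Disjoint U V ∧ K ⊆ U ∪ V ∧ Disjoint U B ∧ Disjoint V A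

section SeparatedBetween

open Filter Topology

variable {X Y : Type*} [TopologicalSpace X] {K L A B : Set X}

theorem SeparatedBetween.mono (hLK : L ⊆ K) (hK : SeparatedBetween K A B) :
    SeparatedBetween L A B := by
  obtain ⟨U, V, hU, hV, hUV, hKUV, hUB, hVA⟩ := hK
  exact ⟨U, V, hU, hV, hUV, hLK.trans hKUV, hUB, hVA⟩

theorem separatedBetween_empty : SeparatedBetween ∅ A B :=
  ⟨∅, ∅, isOpen_empty, isOpen_empty, by simp⟩

theorem SeparatedBetween.sUnion {𝒲 : Set (Set X)} (hopen : ∀ W ∈ 𝒲, IsOpen W)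
    (hdisj : 𝒲.PairwiseDisjoint id) (hsep : ∀ W ∈ 𝒲, SeparatedBetween W A B) :
    SeparatedBetween (⋃₀ 𝒲) A B := by
  choose! U V hU hV hUV hcover hUB hVA using hsep
  refine ⟨⋃ W ∈ 𝒲, W ∩ U W, ⋃ W ∈ 𝒲, W ∩ V W,
    isOpen_biUnion fun W hW => (hopen W hW).inter (hU W hW),
    isOpen_biUnion fun W hW => (hopen W hW).inter (hV W hW), ?_, ?_, ?_, ?_⟩
  · simp only [Set.disjoint_iUnion_left, Set.disjoint_iUnion_right]
    intro W' hW' W hW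
    rcases eq_or_ne W W' with rfl | hne
    · exact (hUV W hW).mono Set.inter_subset_right Set.inter_subset_right
    · exact (hdisj hW hW' hne).mono Set.inter_subset_left Set.inter_subset_left
  · rintro x ⟨W, hW, hxW⟩
    rcases hcover W hW hxW with hxU | hxV
    · exact Or.inl (Set.mem_biUnion hW ⟨hxW, hxU⟩)
    · exact Or.inr (Set.mem_biUnion hW ⟨hxW, hxV⟩)
  · simp only [Set.disjoint_iUnion_left]
    exact fun W hW => (hUB W hW).mono_left Set.inter_subset_right
  · simp only [Set.disjoint_iUnion_left]
    exact fun W hW => (hVA W hW).mono_left Set.inter_subset_right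

theorem SeparatedBetween.eventually_preimage [CompactSpace X] [TopologicalSpace Y] [T2Space Y]
    {f : X → Y} (hf : Continuous f) {p : Y} (hp : SeparatedBetween (f ⁻¹' {p}) A B) :
    ∀ᶠ N in (𝓝 p).smallSets, SeparatedBetween (f ⁻¹' N) A B := by
  obtain ⟨U, V, hU, hV, hUV, hcover, hUB, hVA⟩ := hp
  have hnear : ∀ᶠ q in 𝓝 p, ∀ x, f x = q → x ∈ U ∪ V :=
    hf.isClosedMap.eventually_nhds_fiber p fun x hx => (hU.union hV).mem_nhds (hcover hx)
  refine hnear.smallSets.mono fun N hN => ⟨U, V, hU, hV, hUV, fun x hx => hN _ hx x rfl, hUB, hVA⟩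

theorem exists_isClopen_of_forall_connectedComponent_ne [CompactSpace X] [T2Space X]
    (hA : IsClosed A) (hB : IsClosed B)
    (h : ∀ a ∈ A, ∀ b ∈ B, connectedComponent a ≠ connectedComponent b) :
    ∃ Z : Set X, IsClopen Z ∧ A ⊆ Z ∧ Disjoint Z B := by
  let q : X → ConnectedComponents X := (↑)
  have hq : Continuous q := ConnectedComponents.continuous_coe
  have hdisj : Disjoint (q '' A) (q '' B) := by
    rw [Set.disjoint_left]
    rintro _ ⟨a, ha, rfl⟩ ⟨b, hb, hba⟩
    exact h a ha b hb (ConnectedComponents.coe_eq_coe.1 hba).symm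
  obtain ⟨C, hC, hAC, hCB⟩ := exists_clopen_of_closed_subset_open (hq.isClosedMap A hA)
    (hq.isClosedMap B hB).isOpen_compl hdisj.subset_compl_right
  exact ⟨q ⁻¹' C, hC.preimage hq, Set.image_subset_iff.1 hAC,
    Set.disjoint_left.2 fun b hbC hbB => hCB hbC (Set.mem_image_of_mem q hbB)⟩

theorem separatedBetween_of_forall_isConnected [T2Space X] (hK : IsCompact K) (hA : IsClosed A)
    (hB : IsClosed B)
    (h : ∀ S ⊆ K, IsCompact S → IsConnected S → (S ∩ A).Nonempty → ¬ (S ∩ B).Nonempty) :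
    SeparatedBetween K A B := by
  have : CompactSpace K := isCompact_iff_compactSpace.1 hK
  have hcomp (a b : K) (ha : (a : X) ∈ A) (hb : (b : X) ∈ B) :
      connectedComponent a ≠ connectedComponent b := fun hab =>
    h (Subtype.val '' connectedComponent a) (Subtype.coe_image_subset K _)
      (isClosed_connectedComponent.isCompact.image continuous_subtype_val)
      (isConnected_connectedComponent.image _ continuous_subtype_val.continuousOn)
      ⟨a, Set.mem_image_of_mem _ mem_connectedComponent, ha⟩
      ⟨b, Set.mem_image_of_mem _ (hab ▸ mem_connectedComponent), hb⟩
  obtain ⟨Z, hZ, hAZ, hZB⟩ := exists_isClopen_of_forall_connectedComponent_ne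
    (hA.preimage continuous_subtype_val) (hB.preimage continuous_subtype_val)
    fun a ha b hb => hcomp a b ha hb
  obtain ⟨U, V, hU, hV, hZU, hZV, hUV⟩ := SeparatedNhds.of_isCompact_isCompact
    (hZ.isClosed.isCompact.image continuous_subtype_val)
    (hZ.compl.isClosed.isCompact.image continuous_subtype_val)
    (Set.disjoint_image_of_injective Subtype.val_injective disjoint_compl_right)
  refine ⟨U \ B, V \ A, hU.sdiff hB, hV.sdiff hA, hUV.mono Set.sdiff_subset Set.sdiff_subset, ?_,
    Set.disjoint_sdiff_left, Set.disjoint_sdiff_left⟩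
  intro x hx
  by_cases hxZ : (⟨x, hx⟩ : K) ∈ Z
  · exact Or.inl ⟨hZU ⟨_, hxZ, rfl⟩, Set.disjoint_left.1 hZB hxZ⟩
  · exact Or.inr ⟨hZV ⟨_, hxZ, rfl⟩, fun hxA => hxZ (hAZ hxA)⟩

theorem exists_pos_forall_separatedBetween_preimage [CompactSpace X] [MetricSpace Y] {ι : Type*}
    [Finite ι] {A B : ι → Set X} {f : X → Y} (hf : Continuous f)
    (hsep : ∀ p i, SeparatedBetween (f ⁻¹' {p}) (A i) (B i)) :
    ∃ δ > 0, ∀ s : Set Y, (∀ y ∈ s, ∀ z ∈ s, dist y z < δ) →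
      ∀ i, SeparatedBetween (f ⁻¹' s) (A i) (B i) := by
  have hlocal (p : Y) : ∃ N ∈ 𝓝 p, ∀ i, SeparatedBetween (f ⁻¹' N) (A i) (B i) :=
    (eventually_smallSets' fun _ _ hst ht i => (ht i).mono (Set.preimage_mono hst)).1
      (eventually_all.2 fun i => (hsep p i).eventually_preimage hf)
  choose N hN hNsep using hlocal
  obtain ⟨δ, hδ, hball⟩ := Metric.uniformity_basis_dist.lebesgue_number_lemma_nhds
    (isCompact_range hf) fun p _ => hN p
  refine ⟨δ, hδ, fun s hs i => ?_⟩
  rcases (f ⁻¹' s).eq_empty_or_nonempty with hempty | ⟨x, hx⟩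
  · rw [hempty]
    exact separatedBetween_empty
  · obtain ⟨p, hp⟩ := hball (f x) (Set.mem_range_self x)
    exact (hNsep p i).mono (Set.preimage_mono fun y hy => hp (hs _ hx y hy))

end SeparatedBetween

/-! ### The covering form of the Poincaré–Miranda theorem -/

/-- The point of the unit cube with coordinates `x i / M`, clamped to the unit interval. -/
noncomputable def gridPoint {ι : Type*} (M : ℕ) (x : ι → ℕ) : ι → unitInterval :=
  fun i => Set.projIcc 0 1 zero_le_one ((x i : ℝ) / M)

section UnitCube

variable {ι : Type*}

theorem gridPoint_apply_eq_zero {M : ℕ} {x : ι → ℕ} {i : ι} (hx : x i = 0) :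
    gridPoint M x i = 0 :=
  Set.projIcc_of_le_left _ (by simp [hx])

theorem gridPoint_apply_eq_one {M : ℕ} (hM : M ≠ 0) {x : ι → ℕ} {i : ι} (hx : x i = M) :
    gridPoint M x i = 1 :=
  Set.projIcc_of_right_le _ (by simp [hx, hM])

theorem dist_gridPoint_le [Fintype ι] (M : ℕ) {x y : ι → ℕ} (hy : y ∈ Set.Icc x (x + 1)) :
    dist (gridPoint M y) (gridPoint M x) ≤ 1 / M := by
  refine (dist_pi_le_iff (by positivity)).2 fun i => ?_
  have hxy : (x i : ℝ) ≤ y i := by exact_mod_cast hy.1 i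
  have hyx : (y i : ℝ) ≤ x i + 1 := by exact_mod_cast hy.2 i
  calc
    dist (gridPoint M y i) (gridPoint M x i) ≤ dist ((y i : ℝ) / M) (x i / M) := by
      simpa [gridPoint] using
        (LipschitzWith.projIcc zero_le_one).dist_le_mul ((y i : ℝ) / M) (x i / M)
    _ = (y i - x i) / M := by
      rw [Real.dist_eq, ← sub_div, abs_of_nonneg (div_nonneg (sub_nonneg.2 hxy) M.cast_nonneg)]
    _ ≤ 1 / M := by
      gcongr
      linarith

theorem iUnion_ne_univ_of_separatedBetween_faces [Finite ι] {s : ι → Set (ι → unitInterval)}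
    (hs : ∀ i, SeparatedBetween (s i) {x | x i = 0} {x | x i = 1}) : ⋃ i, s i ≠ Set.univ := by
  classical
  cases nonempty_fintype ι
  intro hcover
  choose L R hL hR hLR hsLR hL1 hR0 using hs
  have hLRcover : Set.univ ⊆ ⋃ k, Sum.elim L R k := by
    rw [← hcover, Set.iUnion_sum, ← Set.iUnion_union_distrib]
    exact Set.iUnion_mono hsLR
  obtain ⟨δ, hδ, hball⟩ := lebesgue_number_lemma_of_metric isCompact_univ
    (Sum.rec hL hR) hLRcover
  obtain ⟨m, hm⟩ := exists_nat_one_div_lt hδ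
  let label (i : ι) (x : ι → ℕ) : ZMod 2 :=
    if gridPoint (m + 1) x ∈ L i ∨ gridPoint (m + 1) x i = 0 then 0 else 1
  have hlabel0 (i x) (hx : x i = 0) : label i x = 0 :=
    if_pos (Or.inr (gridPoint_apply_eq_zero hx))
  have hlabel1 (i x) (hx : x i = m + 1) : label i x = 1 := by
    have hface := gridPoint_apply_eq_one m.succ_ne_zero hx
    exact if_neg (not_or.2 ⟨fun hxL => Set.disjoint_left.1 (hL1 i) hxL hface, by simp [hface]⟩)
  obtain ⟨x, hx⟩ := exists_lattice_cube_forall_exists_ne hlabel0 hlabel1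
  have hnear {y : ι → ℕ} (hy : y ∈ Set.Icc x (x + 1)) :
      gridPoint (m + 1) y ∈ Metric.ball (gridPoint (m + 1) x) δ :=
    (dist_gridPoint_le (m + 1) hy).trans_lt (by exact_mod_cast hm)
  have hself : x ∈ Set.Icc x (x + 1) := Set.left_mem_Icc.2 le_self_add
  obtain ⟨i | i, hi⟩ := hball (gridPoint (m + 1) x) (Set.mem_univ _)
  · have hlabel {y} (hy : y ∈ Set.Icc x (x + 1)) : label i y = 0 :=
      if_pos (Or.inl (hi (hnear hy)))
    obtain ⟨y, hy, hne⟩ := hx i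
    exact hne ((hlabel hy).trans (hlabel hself).symm)
  · have hlabel {y} (hy : y ∈ Set.Icc x (x + 1)) : label i y = 1 :=
      if_neg (not_or.2 ⟨fun hyL => Set.disjoint_left.1 (hLR i) hyL (hi (hnear hy)),
        Set.disjoint_left.1 (hR0 i) (hi (hnear hy))⟩)
    obtain ⟨y, hy, hne⟩ := hx i
    exact hne ((hlabel hy).trans (hlabel hself).symm)

end UnitCube

/-! ### Colored covers -/

/-- `Y` has open covers of arbitrarily small mesh whose members are colored by `ι` so that
distinct members of the same color are disjoint. By Ostrand's theorem, for compact `Y` and finite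
`ι` this says that the covering dimension of `Y` is less than the number of colors. -/
def HasColoredCovers (ι Y : Type*) [PseudoMetricSpace Y] : Prop :=
  ∀ δ > 0, ∃ 𝒲 : ι → Set (Set Y),
    (∀ c, ∀ W ∈ 𝒲 c, IsOpen W ∧ ∀ y ∈ W, ∀ z ∈ W, dist y z < δ) ∧
      (∀ c, (𝒲 c).PairwiseDisjoint id) ∧ ⋃ c, ⋃₀ 𝒲 c = Set.univ

section GridCell

variable {κ : Type*}

/-- An open box of the cubical grid of mesh `δ` whose walls are the hyperplanes
`y j = δ * (a + k)` with `k` an integer. -/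
def gridCell (δ a : ℝ) (z : κ → ℤ) : Set (κ → ℝ) :=
  {y | ∀ j, y j / δ - a - z j ∈ Set.Ioo 0 1}

theorem isOpen_gridCell [Finite κ] (δ a : ℝ) (z : κ → ℤ) : IsOpen (gridCell δ a z) := by
  simp only [gridCell, Set.ofPred_forall]
  exact isOpen_iInter_of_finite fun j => isOpen_Ioo.preimage (by fun_prop)

theorem dist_lt_of_mem_gridCell [Fintype κ] {δ a : ℝ} (hδ : 0 < δ) {z : κ → ℤ} {y y' : κ → ℝ}
    (hy : y ∈ gridCell δ a z) (hy' : y' ∈ gridCell δ a z) : dist y y' < δ := by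
  refine (dist_pi_lt_iff hδ).2 fun j => ?_
  have hscaled : |y j / δ - y' j / δ| < 1 := by
    rw [abs_lt]
    constructor <;> linarith [(hy j).1, (hy j).2, (hy' j).1, (hy' j).2]
  rwa [← sub_div, abs_div, abs_of_pos hδ, div_lt_one hδ] at hscaled

theorem pairwiseDisjoint_range_gridCell (δ a : ℝ) :
    (Set.range (gridCell (κ := κ) δ a)).PairwiseDisjoint id := by
  rintro _ ⟨z, rfl⟩ _ ⟨z', rfl⟩ hne
  refine Set.disjoint_left.2 fun y hy hy' => hne (congrArg _ (funext fun j => ?_))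
  have hfloor {w : κ → ℤ} (hw : y ∈ gridCell δ a w) : ⌊y j / δ - a⌋ = w j :=
    Int.floor_eq_iff.2 ⟨by linarith [(hw j).1], by linarith [(hw j).2]⟩
  exact (hfloor hy).symm.trans (hfloor hy')

theorem exists_mem_gridCell {δ a : ℝ} (ha : a ∈ Set.Ico 0 1) {y : κ → ℝ}
    (hy : ∀ j, Int.fract (y j / δ) ≠ a) : ∃ z, y ∈ gridCell δ a z := by
  refine ⟨fun j => ⌊y j / δ - a⌋, fun j =>
    ⟨Int.fract_pos.2 fun hint => hy j ?_, Int.fract_lt_one _⟩⟩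
  rw [sub_eq_iff_eq_add'.1 hint, Int.fract_add_intCast, Int.fract_eq_self.2 ha]

end GridCell

theorem hasColoredCovers_pi {ι κ : Type*} [Fintype ι] [Fintype κ]
    (hcard : Fintype.card κ < Fintype.card ι) : HasColoredCovers ι (κ → ℝ) := by
  intro δ hδ
  have : Infinite (Set.Ico (0 : ℝ) 1) := (Set.Ico_infinite zero_lt_one).to_subtype
  obtain ⟨toNat⟩ := nonempty_embedding_nat ι
  let offset : ι ↪ Set.Ico (0 : ℝ) 1 := toNat.trans (Infinite.natEmbedding _)
  refine ⟨fun c => Set.range (gridCell δ (offset c)), ?_,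
    fun c => pairwiseDisjoint_range_gridCell _ _, ?_⟩
  · rintro c _ ⟨z, rfl⟩
    exact ⟨isOpen_gridCell _ _ z, fun y hy y' hy' => dist_lt_of_mem_gridCell hδ hy hy'⟩
  · refine Set.eq_univ_of_forall fun y => ?_
    -- A coordinate of `y` lies on walls of at most one translate of the grid.
    have hoff_walls : ∃ c, ∀ j, Int.fract (y j / δ) ≠ offset c := by
      by_contra! h
      choose j hj using h
      have hinj : Function.Injective j := fun c d hcd =>
        offset.injective (Subtype.ext (by rw [← hj c, hcd, hj d]))
      exact hcard.not_ge (Fintype.card_le_of_injective j hinj)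
    obtain ⟨c, hc⟩ := hoff_walls
    obtain ⟨z, hz⟩ := exists_mem_gridCell (offset c).2 hc
    exact Set.mem_iUnion.2 ⟨c, gridCell δ (offset c) z, Set.mem_range_self z, hz⟩

/-! ### Fibers of maps from the cube -/

theorem exists_not_separatedBetween_fiber_faces {ι Y : Type*} [Finite ι] [MetricSpace Y]
    (hY : HasColoredCovers ι Y) {f : (ι → unitInterval) → Y} (hf : Continuous f) :
    ∃ p i, ¬ SeparatedBetween (f ⁻¹' {p}) {x | x i = 0} {x | x i = 1} := by
  by_contra! hsep
  obtain ⟨δ, hδ, hsmall⟩ := exists_pos_forall_separatedBetween_preimage hf hsep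
  obtain ⟨𝒲, h𝒲, hdisj, hcover⟩ := hY δ hδ
  refine iUnion_ne_univ_of_separatedBetween_faces (s := fun i => f ⁻¹' ⋃₀ 𝒲 i) (fun i => ?_) ?_
  · rw [Set.preimage_sUnion, ← Set.sUnion_image]
    refine SeparatedBetween.sUnion ?_ ?_ ?_
    · exact Set.forall_mem_image.2 fun W hW => (h𝒲 i W hW).1.preimage hf
    · rintro _ ⟨W, hW, rfl⟩ _ ⟨W', hW', rfl⟩ hne
      exact (hdisj i hW hW' fun h => hne (congrArg _ h)).preimage f
    · exact Set.forall_mem_image.2 fun W hW => hsmall W (h𝒲 i W hW).2 i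
  · rw [← Set.preimage_iUnion, hcover, Set.preimage_univ]

theorem exists_isConnected_subset_fiber_meets_faces {ι Y : Type*} [Finite ι] [MetricSpace Y]
    (hY : HasColoredCovers ι Y) {f : (ι → unitInterval) → Y} (hf : Continuous f) :
    ∃ p i, ∃ S ⊆ f ⁻¹' {p}, IsCompact S ∧ IsConnected S ∧
      (S ∩ {x | x i = 0}).Nonempty ∧ (S ∩ {x | x i = 1}).Nonempty := by
  obtain ⟨p, i, hsep⟩ := exists_not_separatedBetween_fiber_faces hY hf
  have hface (a : unitInterval) : IsClosed {x : ι → unitInterval | x i = a} :=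
    isClosed_eq (continuous_apply i) continuous_const
  contrapose! hsep
  exact separatedBetween_of_forall_isConnected (isClosed_singleton.preimage hf).isCompact
    (hface 0) (hface 1) fun S hS hSc hSconn hS0 =>
      Set.not_nonempty_iff_eq_empty.2 (hsep p i S hS hSc hSconn hS0)

theorem theoremB_general {n : ℕ} {Y : Type*} [MetricSpace Y] (hY : HasColoredCovers (Fin n) Y)
    (f : (Fin n → ℝ) → Y) (hf : ContinuousOn f (unitCube n)) :
    ∃ (p : Y) (S : Set (Fin n → ℝ)),
      IsCompact S ∧ S ⊆ unitCube n ∩ f ⁻¹' {p} ∧ ConnectsSomeFaces n S := by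
  let incl : (Fin n → unitInterval) → Fin n → ℝ := fun x i => x i
  have hincl : Continuous incl := by fun_prop
  have hcube (x) : incl x ∈ unitCube n := fun i => (x i).2
  obtain ⟨p, i, S, hSp, hSc, hSconn, ⟨x, hxS, hx⟩, y, hyS, hy⟩ :=
    exists_isConnected_subset_fiber_meets_faces hY (hf.comp_continuous hincl hcube)
  have hScube : incl '' S ⊆ unitCube n := Set.image_subset_iff.2 fun x _ => hcube x
  exact ⟨p, incl '' S, hSc.image hincl, Set.subset_inter hScube (Set.image_subset_iff.2 hSp), i,
    hScube, hSconn.image _ hincl.continuousOn,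
    ⟨incl x, Set.mem_image_of_mem _ hxS, hcube x, congrArg Subtype.val hx⟩,
    ⟨incl y, Set.mem_image_of_mem _ hyS, hcube y, congrArg Subtype.val hy⟩⟩

theorem theoremB (n : ℕ) (hn : 1 ≤ n) (f : (Fin n → ℝ) → (Fin (n - 1) → ℝ))
    (hf : ContinuousOn f (unitCube n)) :
    ∃ (p : Fin (n - 1) → ℝ) (S : Set (Fin n → ℝ)),
      IsCompact S ∧ S ⊆ unitCube n ∩ f ⁻¹' {p} ∧ ConnectsSomeFaces n S :=
  theoremB_general (hasColoredCovers_pi (by simpa using Nat.sub_lt hn one_pos)) f hf
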